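/- Let $K\ge d\ge 0$ be integers, let $B\in[0,1]^{K\times K}$ be a symmetric matrix of rank $d$, and let $\tilde\pi>0$. There is an $N_0$, depending only on $B$ and $\tilde\pi$, such that the following holds for every $N\ge N_0$ and all reals $\tilde b>0$, $\hat\beta>0$. Let $\tau:[N]\to[K]$ be a random block membership function and let $A\in\{0,1\}^{N\times N}$ be the adjacency matrix of an undirected stochastic block model: $A$ is symmetric, $A_{ii}=0$, and given $\tau$ the entries $A_{ij}$, $i<j$, are independent Bernoulli variables with parameters $B_{\tau(i)\tau(j)}$. Put $n_k=\#\{u:\tau(u)=k\}$, $D_n=\mathrm{diag}(n_1,\dots,n_K)$ and $\tilde B=BD_nB$. Suppose that, almost surely, 1. $n_k/N\ge\tilde\pi$ for all $k\in[K]$; 2. the $d$-th largest singular value of $\tilde B$ is at least $\tilde b N$; 3. $\tilde B=\tilde\nu\tilde\mu^\top$ for some $\tilde\nu,\tilde\mu\in\mathbb R^{K\times d}$ such that, for all $k\ne l$, the rows satisfy $\|\tilde\nu_k-\tilde\nu_l\|>\hat\beta N$ or $\|\tilde\mu_k-\tilde\mu_l\|>\hat\beta N$. Let $\tilde A=AA$,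 let $\tilde A=U\Sigma V^\top$ be a singular value decomposition with decreasing singular values, and let $S=\tilde U\tilde\Sigma^{1/2}\in\mathbb R^{N\times d}$, where $\tilde U$ consists of the first $d$ columns of $U$ and $\tilde\Sigma$ is the diagonal matrix of the $d$ largest singular values. Let $\hat\tau:[N]\to[K]$ be the assignment in a minimizer $(\hat c,\hat\tau)$ of the $k$-means criterion $\sum_{u=1}^N\|S_u-c_{\tau'(u)}\|_2^2$ over all centroids $c_1,\dots,c_K\in\mathbb R^d$ and all $\tau':[N]\to[K]$. Then, with probability at least $1-2N^{-2}$, $$\min_{\rho}\ \#\{u\in[N]:\tau(u)\ne\rho(\hat\tau(u))\}\ \le\ \frac{2^4\,3^2}{\hat\beta^2(\tilde b\tilde\pi)^5}\cdot\frac{\log N}{N},$$ the minimum being over all permutations $\rho$ of $[K]$, simultaneously for every choice of the singular value decomposition and of the minimizer. -/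

import Mathlib

open MeasureTheory ProbabilityTheory

noncomputable section

namespace DASE

/-- `A` is the random adjacency matrix of an undirected stochastic block model on the nodes
`Fin N` with symmetric block probability matrix `B` and random block membership function `τ`:
`A` is a symmetric 0/1 matrix without self-loops and, given `τ = t`, the entries `A i j`, `i < j`,
are independent Bernoulli variables with parameters `B (t i) (t j)`. No condition is put on the
law of `τ`, so a deterministic `τ` is allowed. -/
structure IsUndirectedSBM {K N : ℕ} {Ω : Type*} [MeasurableSpace Ω]
    (B : Matrix (Fin K) (Fin K) ℝ) (P : Measure Ω) (τ : Ω → Fin N → Fin K)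
    (A : Ω → Matrix (Fin N) (Fin N) ℝ) : Prop where
  measurable_membership : Measurable τ
  measurable_entry : ∀ i j, Measurable fun ω => A ω i j
  zero_or_one : ∀ ω i j, A ω i j = 0 ∨ A ω i j = 1
  symm : ∀ ω, (A ω).IsSymm
  no_loop : ∀ ω i, A ω i i = 0
  bernoulli : ∀ t : Fin N → Fin K, P (τ ⁻¹' {t}) ≠ 0 → ∀ i j : Fin N, i < j →
    (cond P (τ ⁻¹' {t})).real {ω | A ω i j = 1} = B (t i) (t j)
  indep : ∀ t : Fin N → Fin K, P (τ ⁻¹' {t}) ≠ 0 →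
    iIndepFun (fun (e : {e : Fin N × Fin N // e.1 < e.2}) (ω : Ω) => A ω e.1.1 e.1.2)
      (cond P (τ ⁻¹' {t}))

/-- The number of nodes in block `k`. -/
def blockSize {K N : ℕ} (t : Fin N → Fin K) (k : Fin K) : ℕ :=
  (Finset.univ.filter fun u => t u = k).card

/-- `B̃ = B Dₙ B`, with `Dₙ` the diagonal matrix of the block sizes. -/
def doubledBlockMatrix {K N : ℕ} (B : Matrix (Fin K) (Fin K) ℝ) (t : Fin N → Fin K) :
    Matrix (Fin K) (Fin K) ℝ :=
  B * Matrix.diagonal (fun k => (blockSize t k : ℝ)) * B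

/-- The `i`-th largest singular value of a real square matrix, `i = 1, 2, …`. -/
def singularValue {n : ℕ} (M : Matrix (Fin n) (Fin n) ℝ) (i : ℕ) : ℝ :=
  (Matrix.toEuclideanLin M).singularValues (i - 1)

/-- Euclidean distance of the rows `u` and `v` of a matrix. -/
def rowDist {m d : ℕ} (X : Matrix (Fin m) (Fin d) ℝ) (u v : Fin m) : ℝ :=
  ‖WithLp.toLp 2 (X u - X v)‖

/-- `B̃ = ν μᵀ` for some `ν, μ ∈ ℝ^{K × d}` such that, for any two distinct blocks, the
corresponding rows of `ν` or those of `μ` are more than `β` apart. -/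
def IsSeparated {K : ℕ} (Bt : Matrix (Fin K) (Fin K) ℝ) (d : ℕ) (β : ℝ) : Prop :=
  ∃ ν μ : Matrix (Fin K) (Fin d) ℝ, Bt = ν * μ.transpose ∧
    ∀ u v : Fin K, u ≠ v → β < rowDist ν u v ∨ β < rowDist μ u v

/-- `M = U Σ Vᵀ` is a singular value decomposition, with the singular values in decreasing
order. -/
structure IsSVD {n : ℕ} (M U : Matrix (Fin n) (Fin n) ℝ) (σ : Fin n → ℝ)
    (V : Matrix (Fin n) (Fin n) ℝ) : Prop where
  left_orthogonal : U ∈ Matrix.orthogonalGroup (Fin n) ℝ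
  right_orthogonal : V ∈ Matrix.orthogonalGroup (Fin n) ℝ
  nonneg : ∀ i, 0 ≤ σ i
  antitone : Antitone σ
  eq_mul : M = U * Matrix.diagonal σ * V.transpose

/-- `S = U_d Σ_d^{1/2}`, where `U_d` holds the top `d` left singular vectors and `Σ_d` the top `d`
singular values of some singular value decomposition of `M`. -/
def IsSpectralEmbedding {n d : ℕ} (M : Matrix (Fin n) (Fin n) ℝ)
    (S : Matrix (Fin n) (Fin d) ℝ) : Prop :=
  ∃ (U : Matrix (Fin n) (Fin n) ℝ) (σ : Fin n → ℝ) (V : Matrix (Fin n) (Fin n) ℝ) (h : d ≤ n),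
    IsSVD M U σ V ∧
    S = Matrix.of fun u j => U u (Fin.castLE h j) * Real.sqrt (σ (Fin.castLE h j))

/-- The mean square error criterion of `k`-means for the rows of `S`, with centroids `c` and
assignment `τ'`. -/
def kmeansCost {N K d : ℕ} (S : Matrix (Fin N) (Fin d) ℝ) (c : Fin K → Fin d → ℝ)
    (τ' : Fin N → Fin K) : ℝ :=
  ∑ u, ∑ j, (S u j - c (τ' u) j) ^ 2

/-- `τ'` is the block assignment of a global minimizer of the `k`-means criterion. -/
def IsKMeansAssignment {N K d : ℕ} (S : Matrix (Fin N) (Fin d) ℝ) (τ' : Fin N → Fin K) : Prop :=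
  ∃ c : Fin K → Fin d → ℝ, ∀ (c₂ : Fin K → Fin d → ℝ) (τ₂ : Fin N → Fin K),
    kmeansCost S c τ' ≤ kmeansCost S c₂ τ₂

/-- The number of misclustered nodes, minimized over the relabelings of the blocks. -/
def misclustered {N K : ℕ} (t τ' : Fin N → Fin K) : ℕ :=
  Finset.univ.inf' Finset.univ_nonempty fun ρ : Equiv.Perm (Fin K) =>
    (Finset.univ.filter fun u => t u ≠ ρ (τ' u)).card

end DASE

end

noncomputable section

namespace DASE

/-! For large `N` the clustering is exact off an event of probability at most `2 / N ^ 2`. The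
claimed bound is nonnegative, so zero misclustered nodes suffice.

Given the memberships, an off-diagonal entry of `A²` is a sum of independent products up to a
deterministic error of at most 2. Hoeffding's inequality and a union bound put all these entries
within `εN` of `blowUp B t`, for a constant `ε` depending only on `B` and the minimal block fraction
`p` (`prob_deviation_le`). So `A²` is `blowUp B t` plus an error of Frobenius norm at most `2εN²`.
The blow-up is positive semidefinite of rank `d`, and its nonzero eigenvalues have order `N²`. Hence
`d` singular values of `A²` have order `N²`, and the others are at most `2εN²`.

Since `A²` is positive semidefinite, a combination `∑ x u • s u` of embedded points has as squared
norm the quadratic form of `A²` at `x`, truncated to the top `d` directions. For two nodes of one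
block this is `O(ε²N)`, because the blow-up kills the difference of their basis vectors. For the
means of two blocks it is at least of order `N`, because the corresponding columns of `B` differ.
With `ε` small, points cluster tightly around well separated centers, and an optimal `k`-means
assignment must recover the blocks (`exists_perm_of_kmeans_optimal`,
`misclustered_eq_zero_of_close`). That the columns of `B` differ follows from the separation of the
factors of `B̃` (`IsSeparated.col_ne`). -/

open scoped MatrixOrder Matrix.Norms.L2Operator in
/-- Uniqueness of positive semidefinite square roots. -/
lemma posSemidef_eq_of_mul_self_eq {n : ℕ} {M T : Matrix (Fin n) (Fin n) ℝ}
    (hM : M.PosSemidef) (hT : T.PosSemidef) (h : M * M = T * T) : M = T := by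
  rw [← CFC.sqrt_mul_self M hM.nonneg, ← CFC.sqrt_mul_self T hT.nonneg, h]

/-- In a singular value decomposition of a positive semidefinite matrix the right singular vectors
may be replaced by the left ones. -/
lemma IsSVD.eq_mul_left {n : ℕ} {M U V : Matrix (Fin n) (Fin n) ℝ} {σ : Fin n → ℝ}
    (h : IsSVD M U σ V) (hM : M.PosSemidef) :
    M = U * Matrix.diagonal σ * U.transpose := by
  have hU : U.transpose * U = 1 := (Matrix.mem_orthogonalGroup_iff' _ _).1 h.left_orthogonal
  have hV : V.transpose * V = 1 := (Matrix.mem_orthogonalGroup_iff' _ _).1 h.right_orthogonal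
  have hT : (U * Matrix.diagonal σ * U.transpose).PosSemidef := by
    have := (Matrix.PosSemidef.diagonal (R := ℝ) (d := σ) h.nonneg).mul_mul_conjTranspose_same U
    simpa using this
  -- Writing `M²` as `M Mᵀ` eliminates `V` and leaves `U Σ² Uᵀ`.
  refine posSemidef_eq_of_mul_self_eq hM hT ?_
  have hsym : M.transpose = M := by simpa using hM.isHermitian.eq
  have h1 : M * M = M * M.transpose := by rw [hsym]
  rw [h1]
  nth_rw 1 2 [h.eq_mul]
  simp only [Matrix.transpose_mul, Matrix.transpose_transpose, Matrix.diagonal_transpose]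
  calc U * Matrix.diagonal σ * V.transpose * (V * (Matrix.diagonal σ * U.transpose))
      = U * Matrix.diagonal σ * (V.transpose * V) * (Matrix.diagonal σ * U.transpose) := by
        simp only [Matrix.mul_assoc]
    _ = U * Matrix.diagonal σ * (U.transpose * U) * (Matrix.diagonal σ * U.transpose) := by
        rw [hV, hU]
    _ = _ := by simp only [Matrix.mul_assoc]

/-! ### Quadratic forms and min-max bounds for singular values -/

section Spectral

open Matrix

variable {n : ℕ} {M U : Matrix (Fin n) (Fin n) ℝ} {σ : Fin n → ℝ}

lemma sum_sq_transpose_mulVec (hU : U ∈ Matrix.orthogonalGroup (Fin n) ℝ) (x : Fin n → ℝ) :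
    ∑ j, (U.transpose *ᵥ x) j ^ 2 = ∑ u, x u ^ 2 := by
  have hU : U * U.transpose = 1 := (Matrix.mem_orthogonalGroup_iff _ _).1 hU
  have h : (Uᵀ *ᵥ x) ⬝ᵥ (Uᵀ *ᵥ x) = x ⬝ᵥ x := by
    rw [Matrix.dotProduct_mulVec, Matrix.vecMul_transpose, Matrix.mulVec_mulVec, hU,
      Matrix.one_mulVec]
  simpa [dotProduct, sq] using h

lemma dotProduct_mulVec_eq_sum (hM : M = U * Matrix.diagonal σ * U.transpose) (x : Fin n → ℝ) :
    x ⬝ᵥ M *ᵥ x = ∑ j, σ j * (U.transpose *ᵥ x) j ^ 2 := by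
  rw [hM, ← Matrix.mulVec_mulVec, ← Matrix.mulVec_mulVec, Matrix.dotProduct_mulVec,
    ← Matrix.mulVec_transpose]
  simp only [dotProduct, Matrix.mulVec_diagonal]
  exact Finset.sum_congr rfl fun j _ => by ring

lemma sum_sq_mulVec_eq_sum (hU : U ∈ Matrix.orthogonalGroup (Fin n) ℝ)
    (hM : M = U * Matrix.diagonal σ * U.transpose) (x : Fin n → ℝ) :
    ∑ u, (M *ᵥ x) u ^ 2 = ∑ j, σ j ^ 2 * (U.transpose *ᵥ x) j ^ 2 := by
  have h1 : U.transpose * U = 1 := (Matrix.mem_orthogonalGroup_iff' _ _).1 hU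
  rw [← sum_sq_transpose_mulVec hU]
  have : Uᵀ *ᵥ M *ᵥ x = Matrix.diagonal σ *ᵥ (Uᵀ *ᵥ x) := by
    rw [hM, Matrix.mulVec_mulVec, Matrix.mulVec_mulVec, ← Matrix.mul_assoc, ← Matrix.mul_assoc, h1,
      Matrix.one_mul]
  rw [this]
  exact Finset.sum_congr rfl fun j _ => by rw [Matrix.mulVec_diagonal]; ring

/-- A linear map from a space of dimension more than `j` on whose image the quadratic form of `M`
is at least `c` bounds the singular values up to index `j` from below. -/
lemma le_singular_of_form_ge {W : Type*} [AddCommGroup W] [Module ℝ W] [FiniteDimensional ℝ W]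
    (hU : U ∈ Matrix.orthogonalGroup (Fin n) ℝ) (hσ : Antitone σ)
    (hM : M = U * Matrix.diagonal σ * U.transpose) (L : W →ₗ[ℝ] (Fin n → ℝ))
    (hL : Function.Injective L) {c : ℝ}
    (hc : ∀ w, c * ∑ u, L w u ^ 2 ≤ L w ⬝ᵥ M *ᵥ L w) (j : Fin n)
    (hj : j.val < Module.finrank ℝ W) : c ≤ σ j := by
  -- A kernel vector of `T` gives `L w` orthogonal to the first `j` columns of `U`, where the form
  -- is at most `σ j` times the squared norm.
  let T : W →ₗ[ℝ] (Fin j.val → ℝ) :=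
    (LinearMap.funLeft ℝ ℝ (Fin.castLE j.2.le)) ∘ₗ (Matrix.mulVecLin U.transpose) ∘ₗ L
  have hker : LinearMap.ker T ≠ ⊥ := LinearMap.ker_ne_bot_of_finrank_lt (by simpa using hj)
  obtain ⟨w, hw, hw0⟩ := Submodule.exists_mem_ne_zero_of_ne_bot hker
  have hzero : ∀ i : Fin n, i < j → (U.transpose *ᵥ L w) i = 0 := fun i hi => by
    have := congrFun (LinearMap.mem_ker.1 hw) ⟨i.val, hi⟩
    exact this
  have hpos : 0 < ∑ u, L w u ^ 2 := by
    have hne : L w ≠ 0 := fun h => hw0 (hL (by simpa using h))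
    obtain ⟨u, hu⟩ := Function.ne_iff.1 hne
    exact Finset.sum_pos' (fun _ _ => sq_nonneg _) ⟨u, Finset.mem_univ _, by
      have : L w u ≠ 0 := hu
      positivity⟩
  have h1 : L w ⬝ᵥ M *ᵥ L w ≤ σ j * ∑ u, L w u ^ 2 := by
    rw [dotProduct_mulVec_eq_sum hM, ← sum_sq_transpose_mulVec hU, Finset.mul_sum]
    refine Finset.sum_le_sum fun i _ => ?_
    rcases lt_or_ge i j with h | h
    · simp [hzero i h]
    · exact mul_le_mul_of_nonneg_right (hσ h) (sq_nonneg _)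
  exact le_of_mul_le_mul_right ((hc w).trans h1) hpos

/-- If the quadratic form of `M` is at most `c` on the kernel of a linear map into a space of
dimension at most `j`, then so is the singular value of index `j`. -/
lemma singular_le_of_form_le {W : Type*} [AddCommGroup W] [Module ℝ W] [FiniteDimensional ℝ W]
    (hU : U ∈ Matrix.orthogonalGroup (Fin n) ℝ) (hσ : Antitone σ)
    (hM : M = U * Matrix.diagonal σ * U.transpose) (L : (Fin n → ℝ) →ₗ[ℝ] W) {c : ℝ}
    (hc : ∀ x, L x = 0 → x ⬝ᵥ M *ᵥ x ≤ c * ∑ u, x u ^ 2) (j : Fin n)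
    (hj : Module.finrank ℝ W ≤ j.val) : σ j ≤ c := by
  have hUU : U.transpose * U = 1 := (Matrix.mem_orthogonalGroup_iff' _ _).1 hU
  -- Extension by zero: `U *ᵥ J a` runs through the span of the first `j + 1` columns of `U`, which
  -- is too large to miss the kernel of `L`.
  let J : (Fin (j.val + 1) → ℝ) →ₗ[ℝ] (Fin n → ℝ) :=
    { toFun := fun a i => if h : i.val < j.val + 1 then a ⟨i.val, h⟩ else 0
      map_add' := fun a b => by ext i; simp only [Pi.add_apply]; split_ifs <;> simp
      map_smul' := fun r a => by
        ext i; simp only [Pi.smul_apply, RingHom.id_apply]; split_ifs <;> simp }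
  let T := L ∘ₗ (Matrix.mulVecLin U) ∘ₗ J
  have hker : LinearMap.ker T ≠ ⊥ := LinearMap.ker_ne_bot_of_finrank_lt (by simp; omega)
  obtain ⟨a, ha, ha0⟩ := Submodule.exists_mem_ne_zero_of_ne_bot hker
  have hUx : U.transpose *ᵥ (U *ᵥ J a) = J a := by
    rw [Matrix.mulVec_mulVec, hUU, Matrix.one_mulVec]
  have hpos : 0 < ∑ i, J a i ^ 2 := by
    obtain ⟨u, hu⟩ := Function.ne_iff.1 ha0
    refine Finset.sum_pos' (fun _ _ => sq_nonneg _)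
      ⟨⟨u.val, by have := u.2; have := j.2; omega⟩, Finset.mem_univ _, ?_⟩
    have : a u ≠ 0 := hu
    simp only [J, LinearMap.coe_mk, AddHom.coe_mk, u.2, dite_true]
    positivity
  have h1 := hc (U *ᵥ J a) ha
  rw [dotProduct_mulVec_eq_sum hM, ← sum_sq_transpose_mulVec hU, hUx] at h1
  refine le_of_mul_le_mul_right (le_trans ?_ h1) hpos
  rw [Finset.mul_sum]
  refine Finset.sum_le_sum fun i _ => ?_
  by_cases h : i.val < j.val + 1
  · exact mul_le_mul_of_nonneg_right (hσ (by rw [Fin.le_def]; omega)) (sq_nonneg _)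
  · have : J a i = 0 := dif_neg h
    simp [this]

/-- A quadratic form is bounded by the Frobenius norm of its matrix. -/
lemma abs_dotProduct_mulVec_le (E : Matrix (Fin n) (Fin n) ℝ) {F : ℝ} (hF0 : 0 ≤ F)
    (hF : ∑ u, ∑ w, E u w ^ 2 ≤ F ^ 2) (x : Fin n → ℝ) :
    |x ⬝ᵥ E *ᵥ x| ≤ F * ∑ u, x u ^ 2 := by
  have hX : 0 ≤ ∑ u, x u ^ 2 := Finset.sum_nonneg fun _ _ => sq_nonneg _
  have h1 : (x ⬝ᵥ E *ᵥ x) ^ 2 ≤ (∑ u, x u ^ 2) * ∑ u, (E *ᵥ x) u ^ 2 :=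
    Finset.sum_mul_sq_le_sq_mul_sq _ _ _
  have h2 : ∑ u, (E *ᵥ x) u ^ 2 ≤ F ^ 2 * ∑ u, x u ^ 2 := by
    calc ∑ u, (E *ᵥ x) u ^ 2 ≤ ∑ u, (∑ w, E u w ^ 2) * ∑ w, x w ^ 2 :=
          Finset.sum_le_sum fun u _ => Finset.sum_mul_sq_le_sq_mul_sq Finset.univ (E u) x
      _ = (∑ u, ∑ w, E u w ^ 2) * ∑ w, x w ^ 2 := (Finset.sum_mul _ _ _).symm
      _ ≤ _ := mul_le_mul_of_nonneg_right hF hX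
  refine abs_le_of_sq_le_sq ?_ (by positivity)
  calc _ ≤ _ := h1
    _ ≤ (∑ u, x u ^ 2) * (F ^ 2 * ∑ u, x u ^ 2) := mul_le_mul_of_nonneg_left h2 hX
    _ = _ := by ring

end Spectral

/-! ### Exact recovery by `k`-means -/

/-- If points lie within `η` of the centers of their blocks and the centers are well separated,
then an optimal `k`-means assignment recovers the blocks up to relabeling. -/
lemma exists_perm_of_kmeans_optimal {E : Type*} [NormedAddCommGroup E] {N K : ℕ}
    (s : Fin N → E) (t τ' : Fin N → Fin K) (c m : Fin K → E) {η r : ℝ} (hr0 : 0 ≤ r)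
    (hη : ∀ u, ‖s u - m (t u)‖ ≤ η)
    (hopt : ∀ (c₂ : Fin K → E) (τ₂ : Fin N → Fin K),
      ∑ u, ‖s u - c (τ' u)‖ ^ 2 ≤ ∑ u, ‖s u - c₂ (τ₂ u)‖ ^ 2)
    (hpos : ∀ k, 0 < blockSize t k) (hr : ∀ k, N * η ^ 2 ≤ r ^ 2 * blockSize t k)
    (hsep : ∀ k l, k ≠ l → 4 * η + 2 * r < ‖m k - m l‖) :
    ∃ ρ : Equiv.Perm (Fin K), ∀ u, t u = ρ (τ' u) := by
  have hne : ∀ k, ∃ u, t u = k := fun k => by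
    obtain ⟨u, hu⟩ := Finset.card_pos.1 (hpos k)
    exact ⟨u, by simpa using hu⟩
  have hcost : ∑ u, ‖s u - c (τ' u)‖ ^ 2 ≤ N * η ^ 2 := by
    refine (hopt m t).trans ?_
    calc ∑ u, ‖s u - m (t u)‖ ^ 2 ≤ ∑ _u : Fin N, η ^ 2 :=
          Finset.sum_le_sum fun u _ => pow_le_pow_left₀ (norm_nonneg _) (hη u) 2
      _ = N * η ^ 2 := by simp
  -- Otherwise block `k` alone would cost more than `r²` times its size, hence more than the true
  -- clustering.
  have hnear : ∀ k, ∃ u, t u = k ∧ ‖s u - c (τ' u)‖ ≤ r := fun k => by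
    by_contra! h
    have h1 : ∑ u ∈ Finset.univ.filter (fun u => t u = k), r ^ 2
        < ∑ u ∈ Finset.univ.filter (fun u => t u = k), ‖s u - c (τ' u)‖ ^ 2 :=
      Finset.sum_lt_sum_of_nonempty (Finset.card_pos.1 (hpos k)) fun u hu =>
        pow_lt_pow_left₀ (h u (by simpa using hu)) hr0 two_ne_zero
    have h2 : ∑ u ∈ Finset.univ.filter (fun u => t u = k), ‖s u - c (τ' u)‖ ^ 2
        ≤ ∑ u, ‖s u - c (τ' u)‖ ^ 2 :=
      Finset.sum_le_sum_of_subset_of_nonneg (Finset.subset_univ _) fun _ _ _ => sq_nonneg _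
    have h3 := hr k
    rw [Finset.sum_const, nsmul_eq_mul] at h1
    unfold blockSize at h3
    linarith [mul_comm (r ^ 2) ((Finset.univ.filter fun u => t u = k).card : ℝ)]
  choose w hw hwr using hnear
  have hmc : ∀ k, ‖m k - c (τ' (w k))‖ ≤ η + r := fun k => by
    have h1 := hη (w k)
    rw [hw k, norm_sub_rev] at h1
    calc ‖m k - c (τ' (w k))‖ = ‖(m k - s (w k)) + (s (w k) - c (τ' (w k)))‖ := by abel_nf
      _ ≤ _ := (norm_add_le _ _).trans (add_le_add h1 (hwr k))
  have hinj : Function.Injective fun k => τ' (w k) := fun k l hkl => by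
    by_contra hne'
    have h1 := hsep k l hne'
    have h2 := hmc l
    rw [norm_sub_rev, show τ' (w l) = τ' (w k) from hkl.symm] at h2
    have h3 : ‖m k - m l‖ ≤ (η + r) + (η + r) := by
      calc ‖m k - m l‖ = ‖(m k - c (τ' (w k))) + (c (τ' (w k)) - m l)‖ := by abel_nf
        _ ≤ _ := (norm_add_le _ _).trans (add_le_add (hmc k) h2)
    have h4 : 0 ≤ η := (norm_nonneg _).trans (hη (w k))
    linarith
  have hbij : Function.Bijective fun k => τ' (w k) := Finite.injective_iff_bijective.1 hinj
  -- Optimality is tested against relabeling the single point `u`.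
  have hbest : ∀ u j, ‖s u - c (τ' u)‖ ≤ ‖s u - c j‖ := fun u j => by
    have h1 := hopt c (Function.update τ' u j)
    rw [← Finset.add_sum_erase _ _ (Finset.mem_univ u),
      ← Finset.add_sum_erase (a := u) Finset.univ
        (fun v => ‖s v - c (Function.update τ' u j v)‖ ^ 2) (Finset.mem_univ u)] at h1
    have h2 : ∑ v ∈ Finset.univ.erase u, ‖s v - c (Function.update τ' u j v)‖ ^ 2
        = ∑ v ∈ Finset.univ.erase u, ‖s v - c (τ' v)‖ ^ 2 :=
      Finset.sum_congr rfl fun v hv => by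
        rw [Function.update_of_ne (Finset.ne_of_mem_erase hv)]
    rw [h2, Function.update_self] at h1
    exact le_of_sq_le_sq (by linarith) (norm_nonneg _)
  refine ⟨(Equiv.ofBijective _ hbij).symm, fun u => ?_⟩
  rw [Equiv.eq_symm_apply]
  change τ' (w (t u)) = τ' u
  obtain ⟨l, hl⟩ := hbij.2 (τ' u)
  have hl : τ' (w l) = τ' u := hl
  by_contra hcon
  have hlk : t u ≠ l := fun h => hcon (by rw [h, hl])
  have h1 := hbest u (τ' (w (t u)))
  rw [← hl] at h1
  have h2 : ‖s u - c (τ' (w (t u)))‖ ≤ η + (η + r) := by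
    calc _ = ‖(s u - m (t u)) + (m (t u) - c (τ' (w (t u))))‖ := by abel_nf
      _ ≤ _ := (norm_add_le _ _).trans (add_le_add (hη u) (hmc _))
  -- A point given to the centroid of a wrong block `l` is no farther from it than from its own
  -- block's, that is at most `2η + r`. This puts the two centers within `4η + 2r`.
  have h3 : ‖m (t u) - m l‖ ≤ η + (‖s u - c (τ' (w l))‖ + (η + r)) := by
    have e1 := hη u
    have e2 := hmc l
    rw [norm_sub_rev] at e1 e2
    calc _ = ‖(m (t u) - s u) + ((s u - c (τ' (w l))) + (c (τ' (w l)) - m l))‖ := by abel_nf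
      _ ≤ _ := (norm_add_le _ _).trans (add_le_add e1 ((norm_add_le _ _).trans (by gcongr)))
  linarith [hsep _ _ hlk]

/-- A labeling that agrees with `t` up to a permutation has no misclustered nodes. -/
lemma misclustered_eq_zero {N K : ℕ} {t τ' : Fin N → Fin K} (ρ : Equiv.Perm (Fin K))
    (h : ∀ u, t u = ρ (τ' u)) : misclustered t τ' = 0 := by
  refine Nat.le_zero.1 ((Finset.inf'_le _ (Finset.mem_univ ρ)).trans ?_)
  simp [h]

/-! ### The blown-up matrix -/

section Blocks

open Matrix

variable {K N : ℕ} {B : Matrix (Fin K) (Fin K) ℝ} {t : Fin N → Fin K}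

/-- The sums of the entries of a vector over the blocks. -/
def blockSum (t : Fin N → Fin K) (x : Fin N → ℝ) (k : Fin K) : ℝ :=
  ∑ u ∈ Finset.univ.filter (fun u => t u = k), x u

/-- The square of the matrix of edge probabilities between the nodes. -/
def blowUp (B : Matrix (Fin K) (Fin K) ℝ) (t : Fin N → Fin K) : Matrix (Fin N) (Fin N) ℝ :=
  Matrix.of fun u w => doubledBlockMatrix B t (t u) (t w)

lemma sum_mul_blockSum (t : Fin N → Fin K) (x : Fin N → ℝ) (f : Fin K → ℝ) :
    ∑ u, f (t u) * x u = ∑ k, f k * blockSum t x k := by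
  rw [← Finset.sum_fiberwise Finset.univ t]
  refine Finset.sum_congr rfl fun k _ => ?_
  rw [blockSum, Finset.mul_sum]
  exact Finset.sum_congr rfl fun u hu => by rw [(Finset.mem_filter.1 hu).2]

lemma blockSum_comp (t : Fin N → Fin K) (w : Fin K → ℝ) (k : Fin K) :
    blockSum t (fun u => w (t u)) k = blockSize t k * w k := by
  rw [blockSum, blockSize, ← nsmul_eq_mul, ← Finset.sum_const]
  exact Finset.sum_congr rfl fun u hu => by rw [(Finset.mem_filter.1 hu).2]

lemma sum_comp_eq_sum_blockSize (t : Fin N → Fin K) (f : Fin K → ℝ) :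
    ∑ u, f (t u) = ∑ k, blockSize t k * f k := by
  have := sum_mul_blockSum t (fun _ => 1) f
  simp only [mul_one] at this
  rw [this]
  refine Finset.sum_congr rfl fun k _ => ?_
  simp [blockSum, blockSize, mul_comm]

/-- The blow-up sees a vector only through its block sums, and `B Dₙ B` with `B` symmetric is a Gram
matrix weighted by the block sizes. -/
lemma form_blowUp (hB : B.IsSymm) (t : Fin N → Fin K) (x : Fin N → ℝ) :
    x ⬝ᵥ blowUp B t *ᵥ x = ∑ m, blockSize t m * (B *ᵥ blockSum t x) m ^ 2 := by
  have h1 : ∀ u, (blowUp B t *ᵥ x) u = (doubledBlockMatrix B t *ᵥ blockSum t x) (t u) := fun u =>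
    sum_mul_blockSum t x (fun l => doubledBlockMatrix B t (t u) l)
  have h2 : x ⬝ᵥ blowUp B t *ᵥ x
      = blockSum t x ⬝ᵥ doubledBlockMatrix B t *ᵥ blockSum t x := by
    have := sum_mul_blockSum t x (doubledBlockMatrix B t *ᵥ blockSum t x)
    rw [dotProduct_comm (blockSum t x), dotProduct_comm x]
    refine Eq.trans (Finset.sum_congr rfl fun u _ => ?_) this
    rw [h1]
  rw [h2, doubledBlockMatrix, ← Matrix.mulVec_mulVec, ← Matrix.mulVec_mulVec,
    Matrix.dotProduct_mulVec, ← Matrix.mulVec_transpose, hB.eq]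
  simp only [dotProduct, Matrix.mulVec_diagonal]
  exact Finset.sum_congr rfl fun j _ => by ring

/-- Vectors in the range of a matrix have preimages of comparable length. -/
lemma exists_bounded_preimage (B : Matrix (Fin K) (Fin K) ℝ) :
    ∃ C : ℝ, 0 < C ∧ ∀ w ∈ LinearMap.range B.mulVecLin,
      ∃ z, B *ᵥ z = w ∧ ∑ k, z k ^ 2 ≤ C * ∑ k, w k ^ 2 := by
  -- A linear section over the range is bounded in finite dimension. The factor `K` passes from the
  -- sup norm to the sum of squares, and the `+ 1` makes the constant positive.
  obtain ⟨g, hg⟩ := B.mulVecLin.rangeRestrict.exists_rightInverse_of_surjective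
    (LinearMap.range_rangeRestrict _)
  let G := LinearMap.toContinuousLinearMap g
  refine ⟨K * ‖G‖ ^ 2 + 1, by positivity, fun w hw => ⟨g ⟨w, hw⟩, ?_, ?_⟩⟩
  · exact congrArg Subtype.val (LinearMap.congr_fun hg ⟨w, hw⟩)
  · have h1 : ‖g ⟨w, hw⟩‖ ≤ ‖G‖ * ‖w‖ := G.le_opNorm ⟨w, hw⟩
    have hw0 : 0 ≤ ∑ k, w k ^ 2 := Finset.sum_nonneg fun _ _ => sq_nonneg _
    have h2 : ‖w‖ ^ 2 ≤ ∑ k, w k ^ 2 := by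
      have : ‖w‖ ≤ Real.sqrt (∑ k, w k ^ 2) :=
        (pi_norm_le_iff_of_nonneg (Real.sqrt_nonneg _)).2 fun k => by
          rw [Real.norm_eq_abs]
          exact Real.abs_le_sqrt
            (Finset.single_le_sum (f := fun k => w k ^ 2) (fun _ _ => sq_nonneg _)
              (Finset.mem_univ k))
      calc ‖w‖ ^ 2 ≤ Real.sqrt (∑ k, w k ^ 2) ^ 2 := pow_le_pow_left₀ (norm_nonneg _) this 2
        _ = _ := Real.sq_sqrt hw0
    have h3 : ∀ k, g ⟨w, hw⟩ k ^ 2 ≤ ‖G‖ ^ 2 * ∑ k, w k ^ 2 := fun k => by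
      have h4 : |g ⟨w, hw⟩ k| ≤ ‖G‖ * ‖w‖ := (norm_le_pi_norm (g ⟨w, hw⟩) k).trans h1
      calc g ⟨w, hw⟩ k ^ 2 = |g ⟨w, hw⟩ k| ^ 2 := (sq_abs _).symm
        _ ≤ (‖G‖ * ‖w‖) ^ 2 := pow_le_pow_left₀ (abs_nonneg _) h4 2
        _ = ‖G‖ ^ 2 * ‖w‖ ^ 2 := by ring
        _ ≤ _ := by gcongr
    calc ∑ k, g ⟨w, hw⟩ k ^ 2 ≤ ∑ _k : Fin K, ‖G‖ ^ 2 * ∑ k, w k ^ 2 :=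
          Finset.sum_le_sum fun k _ => h3 k
      _ = K * ‖G‖ ^ 2 * ∑ k, w k ^ 2 := by simp; ring
      _ ≤ _ := by nlinarith

/-- The quadratic form of `blowUp B t` is bounded below on the vectors that come from the range
of `B`. -/
lemma form_blowUp_ge (hB : B.IsSymm) {C p : ℝ} (hC : 0 < C) (hp : 0 ≤ p)
    (hn : ∀ k, p ≤ blockSize t k) {w z : Fin K → ℝ} (hz : B *ᵥ z = w)
    (hzw : ∑ k, z k ^ 2 ≤ C * ∑ k, w k ^ 2) :
    p ^ 2 / C * ∑ u, w (t u) ^ 2 ≤ (fun u => w (t u)) ⬝ᵥ blowUp B t *ᵥ (fun u => w (t u)) := by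
  rw [form_blowUp hB, sum_comp_eq_sum_blockSize t (fun k => w k ^ 2)]
  set s := blockSum t (fun u => w (t u)) with hs
  set q := ∑ k, (blockSize t k : ℝ) * w k ^ 2 with hq
  set V := ∑ m, (B *ᵥ s) m ^ 2 with hV
  have hV0 : 0 ≤ V := Finset.sum_nonneg fun _ _ => sq_nonneg _
  have hq0 : 0 ≤ q := Finset.sum_nonneg fun _ _ => by positivity
  have h1 : p * V ≤ ∑ m, blockSize t m * (B *ᵥ s) m ^ 2 := by
    rw [hV, Finset.mul_sum]
    exact Finset.sum_le_sum fun m _ => mul_le_mul_of_nonneg_right (hn m) (sq_nonneg _)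
  have h2 : p * ∑ k, w k ^ 2 ≤ q := by
    rw [Finset.mul_sum]
    exact Finset.sum_le_sum fun m _ => mul_le_mul_of_nonneg_right (hn m) (sq_nonneg _)
  -- Here `q` pairs `w = B z` with the block sums `s = Dₙ w`. Moving `B` across and applying
  -- Cauchy–Schwarz bounds `q` by the form at `s`.
  have h3 : q = z ⬝ᵥ B *ᵥ s := by
    rw [Matrix.dotProduct_mulVec, ← Matrix.mulVec_transpose, hB.eq, hz, hq]
    refine Finset.sum_congr rfl fun k _ => ?_
    rw [hs, blockSum_comp]; ring
  have h4 : q ^ 2 ≤ (∑ k, z k ^ 2) * V := by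
    rw [h3]; exact Finset.sum_mul_sq_le_sq_mul_sq _ _ _
  refine le_trans ?_ h1
  rcases hq0.eq_or_lt with h | h
  · rw [← h]; simp; positivity
  · have h5 : p * q ≤ C * V := by
      have h6 : p * q * q ≤ C * V * q := by
        calc p * q * q = p * q ^ 2 := by ring
          _ ≤ p * ((C * ∑ k, w k ^ 2) * V) := by gcongr; exact h4.trans (by gcongr)
          _ = C * V * (p * ∑ k, w k ^ 2) := by ring
          _ ≤ C * V * q := by gcongr
      exact le_of_mul_le_mul_right h6 h
    calc p ^ 2 / C * q = p * (p * q) / C := by ring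
      _ ≤ p * (C * V) / C := by gcongr
      _ = p * V := by field_simp

end Blocks

lemma sum_castLE {n d : ℕ} (h : d ≤ n) (f : Fin n → ℝ) :
    ∑ j : Fin d, f (Fin.castLE h j) = ∑ i, if i.val < d then f i else 0 := by
  obtain ⟨m, rfl⟩ := Nat.exists_eq_add_of_le h
  rw [Fin.sum_univ_add]
  simp [Fin.castAdd]

/-! ### Geometry of the spectral embedding -/

section Embedding

open Matrix

variable {n d : ℕ} {M U : Matrix (Fin n) (Fin n) ℝ} {σ : Fin n → ℝ}

/-- Distances between points and between block means both have this shape, so the truncated form of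
`M` governs all the geometry needed, whichever decomposition is chosen. -/
lemma norm_sq_sum_smul_embedding (hσ : ∀ i, 0 ≤ σ i) (h : d ≤ n) (x : Fin n → ℝ) :
    ‖∑ u, x u • WithLp.toLp 2
        (fun j : Fin d => U u (Fin.castLE h j) * Real.sqrt (σ (Fin.castLE h j)))‖ ^ 2
      = ∑ j : Fin d, σ (Fin.castLE h j) * (U.transpose *ᵥ x) (Fin.castLE h j) ^ 2 := by
  rw [EuclideanSpace.real_norm_sq_eq]
  refine Finset.sum_congr rfl fun j _ => ?_
  have : (∑ u, x u • WithLp.toLp 2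
        (fun j : Fin d => U u (Fin.castLE h j) * Real.sqrt (σ (Fin.castLE h j)))) j
      = Real.sqrt (σ (Fin.castLE h j)) * (U.transpose *ᵥ x) (Fin.castLE h j) := by
    rw [WithLp.ofLp_sum, Finset.sum_apply]
    simp only [Matrix.mulVec, dotProduct, Matrix.transpose_apply, Finset.mul_sum]
    exact Finset.sum_congr rfl fun u _ => by simp; ring
  rw [this, mul_pow, Real.sq_sqrt (hσ _)]

/-- Termwise `c σ ≤ σ²` on the top indices. This is the upper bound for distances inside a block. -/
lemma mul_sum_castLE_le (hU : U ∈ Matrix.orthogonalGroup (Fin n) ℝ) (hσ : ∀ i, 0 ≤ σ i)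
    (hM : M = U * Matrix.diagonal σ * U.transpose) (h : d ≤ n) {c : ℝ}
    (hc : ∀ i : Fin n, i.val < d → c ≤ σ i) (x : Fin n → ℝ) :
    c * ∑ j : Fin d, σ (Fin.castLE h j) * (U.transpose *ᵥ x) (Fin.castLE h j) ^ 2
      ≤ ∑ u, (M *ᵥ x) u ^ 2 := by
  rw [sum_castLE h (fun i => σ i * (U.transpose *ᵥ x) i ^ 2), sum_sq_mulVec_eq_sum hU hM,
    Finset.mul_sum]
  refine Finset.sum_le_sum fun i _ => ?_
  split_ifs with hi
  · have := mul_le_mul_of_nonneg_right (hc i hi)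
      (mul_nonneg (hσ i) (sq_nonneg ((U.transpose *ᵥ x) i)))
    linarith
  · have := hσ i
    simp only [mul_zero]; positivity

/-- Truncation discards only directions with singular value at most `c`. This is the lower bound for
distances between centers. -/
lemma form_sub_le_sum_castLE (hU : U ∈ Matrix.orthogonalGroup (Fin n) ℝ)
    (hM : M = U * Matrix.diagonal σ * U.transpose) (h : d ≤ n) {c : ℝ} (hc0 : 0 ≤ c)
    (hc : ∀ i : Fin n, d ≤ i.val → σ i ≤ c) (x : Fin n → ℝ) :
    x ⬝ᵥ M *ᵥ x - c * ∑ u, x u ^ 2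
      ≤ ∑ j : Fin d, σ (Fin.castLE h j) * (U.transpose *ᵥ x) (Fin.castLE h j) ^ 2 := by
  rw [sum_castLE h (fun i => σ i * (U.transpose *ᵥ x) i ^ 2), dotProduct_mulVec_eq_sum hM,
    ← sum_sq_transpose_mulVec hU, Finset.mul_sum, ← Finset.sum_sub_distrib]
  refine Finset.sum_le_sum fun i _ => ?_
  split_ifs with hi
  · have : 0 ≤ c * (U.transpose *ᵥ x) i ^ 2 := by positivity
    linarith
  · have := mul_le_mul_of_nonneg_right (hc i (not_lt.1 hi)) (sq_nonneg ((U.transpose *ᵥ x) i))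
    linarith

end Embedding

/-! ### Deterministic recovery from entrywise closeness -/

section Recovery

open Matrix

variable {K N d : ℕ}

/-- The diagonal is controlled only trivially, but its total `N³` is absorbed by `ε²N⁴`. -/
lemma sum_sq_le_of_entrywise {E : Matrix (Fin N) (Fin N) ℝ} {ε : ℝ}
    (hoff : ∀ u w, u ≠ w → |E u w| ≤ ε * N) (hdiag : ∀ u, |E u u| ≤ N) (hN : 1 ≤ N * ε ^ 2) :
    ∑ u, ∑ w, E u w ^ 2 ≤ (2 * ε * N ^ 2) ^ 2 := by
  have hentry : ∀ u w, E u w ^ 2 ≤ (ε * N) ^ 2 + if u = w then (N : ℝ) ^ 2 else 0 := fun u w => by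
    rw [← sq_abs]
    split_ifs with h
    · subst h
      have := pow_le_pow_left₀ (abs_nonneg _) (hdiag u) 2
      nlinarith [sq_nonneg (ε * N)]
    · rw [add_zero]
      exact pow_le_pow_left₀ (abs_nonneg _) (hoff u w h) 2
  calc ∑ u, ∑ w, E u w ^ 2
      ≤ ∑ u : Fin N, ∑ w : Fin N, ((ε * N) ^ 2 + if u = w then (N : ℝ) ^ 2 else 0) :=
        Finset.sum_le_sum fun u _ => Finset.sum_le_sum fun w _ => hentry u w
    _ = N ^ 4 * ε ^ 2 + N ^ 3 * 1 := by
        simp [Finset.sum_add_distrib]; ring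
    _ ≤ N ^ 4 * ε ^ 2 + N ^ 3 * (N * ε ^ 2) := by gcongr
    _ ≤ _ := by nlinarith [show (0 : ℝ) ≤ N ^ 4 * ε ^ 2 by positivity]

/-- Only the indices `u` and `v` meet the diagonal. Their `8N²` is absorbed by one further `ε²N³`.
-/
lemma sum_sq_row_sub_le {E : Matrix (Fin N) (Fin N) ℝ} {ε : ℝ} (hε1 : ε ≤ 1)
    (hoff : ∀ u w, u ≠ w → |E u w| ≤ ε * N) (hdiag : ∀ u, |E u u| ≤ N) (hN : 8 ≤ N * ε ^ 2)
    (u v : Fin N) : ∑ w, (E w u - E w v) ^ 2 ≤ 5 * ε ^ 2 * N ^ 3 := by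
  have hbound : ∀ w z, |E w z| ≤ ε * N + if w = z then (1 - ε) * N else 0 := fun w z => by
    split_ifs with h
    · subst h; linarith [hdiag w]
    · rw [add_zero]; exact hoff w z h
  have hN0 : (0 : ℝ) ≤ N := Nat.cast_nonneg _
  have hentry : ∀ w, (E w u - E w v) ^ 2
      ≤ (2 * ε * N) ^ 2 + ((if w = u then 4 * (N : ℝ) ^ 2 else 0)
        + if w = v then 4 * (N : ℝ) ^ 2 else 0) := fun w => by
    have h1 : |E w u - E w v| ≤ |E w u| + |E w v| := abs_sub _ _
    have hall : ∀ z, |E w z| ≤ N := fun z => by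
      refine (hbound w z).trans ?_
      split_ifs <;> nlinarith
    by_cases hu : w = u ∨ w = v
    · have h2 : (E w u - E w v) ^ 2 ≤ (2 * (N : ℝ)) ^ 2 := by
        rw [← sq_abs]
        exact pow_le_pow_left₀ (abs_nonneg _) (by linarith [hall u, hall v]) 2
      have h3 : (4 : ℝ) * N ^ 2 ≤ (if w = u then 4 * (N : ℝ) ^ 2 else 0)
          + if w = v then 4 * (N : ℝ) ^ 2 else 0 := by
        have h4 : (0 : ℝ) ≤ 4 * N ^ 2 := by positivity
        rcases hu with h | h
        · rw [if_pos h]; split_ifs <;> linarith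
        · rw [if_pos h]; split_ifs <;> linarith
      nlinarith [sq_nonneg (2 * ε * N)]
    · push Not at hu
      rw [if_neg hu.1, if_neg hu.2, add_zero, add_zero, ← sq_abs]
      exact pow_le_pow_left₀ (abs_nonneg _)
        (by linarith [hoff w u hu.1, hoff w v hu.2]) 2
  calc ∑ w, (E w u - E w v) ^ 2 ≤ ∑ w : Fin N, ((2 * ε * N) ^ 2
        + ((if w = u then 4 * (N : ℝ) ^ 2 else 0) + if w = v then 4 * (N : ℝ) ^ 2 else 0)) :=
        Finset.sum_le_sum fun w _ => hentry w
    _ = 4 * ε ^ 2 * N ^ 3 + 8 * N ^ 2 := by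
        simp [Finset.sum_add_distrib]; ring
    _ ≤ 4 * ε ^ 2 * N ^ 3 + (N * ε ^ 2) * N ^ 2 := by gcongr
    _ = _ := by ring

/-- If the entries of `A²` are close to those of the blown-up matrix `B̃`, then `k`-means on the
spectral embedding of `A²` recovers the blocks exactly. -/
theorem misclustered_eq_zero_of_close {B : Matrix (Fin K) (Fin K) ℝ} (hB : B.IsSymm)
    (hrank : B.rank = d) {C δ p ε : ℝ} (hC : 0 < C)
    (hrange : ∀ w ∈ LinearMap.range B.mulVecLin,
      ∃ z, B *ᵥ z = w ∧ ∑ k, z k ^ 2 ≤ C * ∑ k, w k ^ 2)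
    (hδ : ∀ k l, k ≠ l → δ ≤ ∑ m, (B m k - B m l) ^ 2) (hp : 0 < p)
    (hε0 : 0 < ε) (hε1 : ε ≤ 1) (hε2 : 4 * ε ≤ p ^ 2 / C)
    (hε3 : 360 * C * ε ^ 2 / p ^ 3 + 8 * ε / p < p * δ)
    {t : Fin N → Fin K} {A : Matrix (Fin N) (Fin N) ℝ} (hA : A.IsSymm)
    (hn : ∀ k, p * N ≤ blockSize t k) (hN : 8 ≤ N * ε ^ 2)
    (hoff : ∀ u w, u ≠ w → |(A * A) u w - doubledBlockMatrix B t (t u) (t w)| ≤ ε * N)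
    (hdiag : ∀ u, |(A * A) u u - doubledBlockMatrix B t (t u) (t u)| ≤ N)
    {S : Matrix (Fin N) (Fin d) ℝ} {τ' : Fin N → Fin K}
    (hS : IsSpectralEmbedding (A * A) S) (hτ : IsKMeansAssignment S τ') :
    misclustered t τ' = 0 := by
  obtain ⟨U, σ, V, hdN, hsvd, rfl⟩ := hS
  have hPSD : (A * A).PosSemidef := by
    have := Matrix.posSemidef_conjTranspose_mul_self A
    rwa [Matrix.conjTranspose_eq_transpose_of_trivial, hA.eq] at this
  have hNpos : (0 : ℝ) < N := by
    rcases (Nat.cast_nonneg (α := ℝ) N).eq_or_lt with h | h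
    · rw [← h] at hN; norm_num at hN
    · exact h
  have hM := hsvd.eq_mul_left hPSD
  have hU := hsvd.left_orthogonal
  set M := A * A with hMdef
  set E := M - blowUp B t with hE
  have hoffE : ∀ u w, u ≠ w → |E u w| ≤ ε * N := hoff
  have hdiagE : ∀ u, |E u u| ≤ N := hdiag
  set F := 2 * ε * (N : ℝ) ^ 2 with hFdef
  have hF0 : 0 ≤ F := by positivity
  have hFrob := sum_sq_le_of_entrywise hoffE hdiagE (by linarith)
  have hform : ∀ x : Fin N → ℝ, |x ⬝ᵥ M *ᵥ x - x ⬝ᵥ blowUp B t *ᵥ x| ≤ F * ∑ u, x u ^ 2 :=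
    fun x => by
      have := abs_dotProduct_mulVec_le E hF0 hFrob x
      rwa [hE, Matrix.sub_mulVec, dotProduct_sub] at this
  have hblock : ∀ k, (0 : ℝ) < blockSize t k := fun k => lt_of_lt_of_le (by positivity) (hn k)
  have hsurj : ∀ k, ∃ u, t u = k := fun k => by
    obtain ⟨u, hu⟩ := Finset.card_pos.1 (show 0 < (Finset.univ.filter fun u => t u = k).card from
      by exact_mod_cast hblock k)
    exact ⟨u, by simpa using hu⟩
  -- the top singular values
  set c₁ := p ^ 2 / (2 * C) * (N : ℝ) ^ 2 with hc₁
  have hc₁0 : 0 < c₁ := by positivity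
  have htop : ∀ i : Fin N, i.val < d → c₁ ≤ σ i := fun i hi => by
    -- The `d`-dimensional test space: block-constant vectors with values in the range of `B`.
    let L : LinearMap.range B.mulVecLin →ₗ[ℝ] (Fin N → ℝ) :=
      (LinearMap.funLeft ℝ ℝ t) ∘ₗ (LinearMap.range B.mulVecLin).subtype
    have hL : Function.Injective L := fun w w' h => by
      ext k
      obtain ⟨u, rfl⟩ := hsurj k
      exact congrFun h u
    refine le_singular_of_form_ge hU hsvd.antitone hM L hL (fun w => ?_) i ?_
    · obtain ⟨z, hz, hzw⟩ := hrange w.1 w.2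
      have h1 := form_blowUp_ge hB hC (by positivity) hn hz hzw
      have h2 := hform (L w)
      have h1 : (p * N) ^ 2 / C * ∑ u, L w u ^ 2 ≤ L w ⬝ᵥ blowUp B t *ᵥ L w := h1
      have h3 : 0 ≤ ∑ u, L w u ^ 2 := Finset.sum_nonneg fun _ _ => sq_nonneg _
      have h4 : c₁ + F ≤ (p * N) ^ 2 / C := by
        have e1 : (p * N) ^ 2 / C = 2 * c₁ := by rw [hc₁]; field_simp
        have e2 : c₁ = p ^ 2 / C / 2 * (N : ℝ) ^ 2 := by rw [hc₁]; field_simp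
        have e3 : F ≤ c₁ := by
          rw [e2, hFdef]; gcongr; linarith
        linarith
      have h5 := mul_le_mul_of_nonneg_right h4 h3
      linarith [(abs_le.1 h2).1]
    · have : Module.finrank ℝ (LinearMap.range B.mulVecLin) = d := hrank
      rwa [this]
  have hbot : ∀ i : Fin N, d ≤ i.val → σ i ≤ F := fun i hi => by
    -- The blow-up form vanishes on the kernel of `T`, so only the error survives there.
    let T : (Fin N → ℝ) →ₗ[ℝ] LinearMap.range B.mulVecLin :=
      B.mulVecLin.rangeRestrict ∘ₗ
        { toFun := blockSum t
          map_add' := fun x y => by ext k; simp [blockSum, Finset.sum_add_distrib]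
          map_smul' := fun r x => by ext k; simp [blockSum, Finset.mul_sum] }
    refine singular_le_of_form_le hU hsvd.antitone hM T (fun x hx => ?_) i ?_
    · have h1 : B *ᵥ blockSum t x = 0 := congrArg Subtype.val hx
      have h2 := hform x
      rw [form_blowUp hB, h1] at h2
      simp only [Pi.zero_apply] at h2
      norm_num at h2
      exact (le_abs_self _).trans h2
    · have : Module.finrank ℝ (LinearMap.range B.mulVecLin) = d := hrank
      rwa [this]
  -- the embedded points and the centers
  set s : Fin N → EuclideanSpace ℝ (Fin d) := fun u => WithLp.toLp 2
    (fun j : Fin d => U u (Fin.castLE hdN j) * Real.sqrt (σ (Fin.castLE hdN j))) with hs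
  -- `η²` is `5ε²N³ / c₁`, and `r² = η² / p` is what the block size bound `pN` requires in
  -- `k`-means.
  set η := Real.sqrt (10 * C * ε ^ 2 * N / p ^ 2) with hη
  have hη2 : η ^ 2 = 10 * C * ε ^ 2 * N / p ^ 2 := Real.sq_sqrt (by positivity)
  set r := Real.sqrt (10 * C * ε ^ 2 * N / p ^ 3) with hr
  have hr2 : r ^ 2 = 10 * C * ε ^ 2 * N / p ^ 3 := Real.sq_sqrt (by positivity)
  have hclose : ∀ u v, t u = t v → ‖s u - s v‖ ≤ η := fun u v huv => by
    let x : Fin N → ℝ := Pi.single u 1 - Pi.single v 1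
    have h1 : s u - s v = ∑ i, x i • s i := by
      simp [x, sub_smul, Finset.sum_sub_distrib, Pi.single_apply]
    have h2 := norm_sq_sum_smul_embedding (U := U) hsvd.nonneg hdN x
    have h3 := mul_sum_castLE_le hU hsvd.nonneg hM hdN htop x
    have h4 : ∀ w, (M *ᵥ x) w = E w u - E w v := fun w => by
      have : (M *ᵥ x) w = M w u - M w v := by
        simp [x, Matrix.mulVec_sub]
      rw [this, hE]
      simp [blowUp, huv]
    simp only [h4] at h3
    have h5 := h3.trans (sum_sq_row_sub_le hε1 hoffE hdiagE hN u v)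
    rw [← h2] at h5
    rw [h1]
    refine le_of_sq_le_sq ?_ (Real.sqrt_nonneg _)
    rw [hη2]
    refine le_of_mul_le_mul_left (h5.trans (le_of_eq ?_)) hc₁0
    rw [hc₁]; field_simp; ring
  set m : Fin K → EuclideanSpace ℝ (Fin d) := fun k =>
    (blockSize t k : ℝ)⁻¹ • ∑ u ∈ Finset.univ.filter (fun u => t u = k), s u with hm
  have hnear : ∀ u, ‖s u - m (t u)‖ ≤ η := fun u => by
    have h1 : s u - m (t u) = (blockSize t (t u) : ℝ)⁻¹ •
        ∑ v ∈ Finset.univ.filter (fun v => t v = t u), (s u - s v) := by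
      rw [Finset.sum_sub_distrib, smul_sub, Finset.sum_const, ← Nat.cast_smul_eq_nsmul ℝ, smul_smul]
      change _ = ((blockSize t (t u) : ℝ)⁻¹ * (blockSize t (t u) : ℝ)) • s u - _
      rw [inv_mul_cancel₀ (hblock _).ne', one_smul]
    rw [h1, norm_smul, norm_inv, Real.norm_of_nonneg (hblock _).le, inv_mul_le_iff₀ (hblock _)]
    refine (norm_sum_le _ _).trans ((Finset.sum_le_card_nsmul _ _ η fun v hv => ?_).trans ?_)
    · exact hclose u v (Finset.mem_filter.1 hv).2.symm
    · rw [nsmul_eq_mul]; rfl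
  have hsep : ∀ k l, k ≠ l → N * (p * δ - 8 * ε / p) ≤ ‖m k - m l‖ ^ 2 := fun k l hkl => by
    -- Averaging keeps the block sums at `±1` while shrinking the squared norm of `x` to order
    -- `1/N`. The error `F`, of order `εN²`, thus costs only `O(εN)`; it is paid twice, for
    -- perturbation and for truncation.
    let f : Fin K → ℝ := fun a => (if a = k then (blockSize t k : ℝ)⁻¹ else 0)
      - if a = l then (blockSize t l : ℝ)⁻¹ else 0
    let x : Fin N → ℝ := fun u => f (t u)
    have h1 : m k - m l = ∑ u, x u • s u := by
      simp only [x, f, sub_smul, Finset.sum_sub_distrib, ite_smul, zero_smul, hm, Finset.smul_sum,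
        Finset.sum_filter, smul_ite, smul_zero]
    have hx : ∑ u, x u ^ 2 ≤ 2 / (p * N) := by
      have h2 := sum_comp_eq_sum_blockSize t (fun a => f a ^ 2)
      have h3 : ∀ a, (blockSize t a : ℝ) * f a ^ 2
          = (if a = k then (blockSize t k : ℝ)⁻¹ else 0)
            + if a = l then (blockSize t l : ℝ)⁻¹ else 0 := fun a => by
        have := (hblock k).ne'
        have := (hblock l).ne'
        simp only [f]
        by_cases hak : a = k
        · subst hak
          simp only [if_true, if_neg hkl]
          field_simp; ring
        · by_cases hal : a = l
          · subst hal
            simp only [if_true, if_neg hak]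
            field_simp; ring
          · simp [hak, hal]
      simp only [h3] at h2
      calc ∑ u, x u ^ 2 = _ := h2
        _ = (blockSize t k : ℝ)⁻¹ + (blockSize t l : ℝ)⁻¹ := by
          simp [Finset.sum_add_distrib]
        _ ≤ (p * N)⁻¹ + (p * N)⁻¹ := by
          gcongr
          · exact hn k
          · exact hn l
        _ = _ := by ring
    have hbs : blockSum t x = Pi.single k 1 - Pi.single l 1 := by
      ext a
      have := (hblock k).ne'
      have := (hblock l).ne'
      rw [show blockSum t x a = _ from blockSum_comp t f a, Pi.sub_apply, Pi.single_apply,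
        Pi.single_apply]
      simp only [f]
      by_cases hak : a = k
      · subst hak
        simp only [if_true, if_neg hkl]
        field_simp; simp
      · by_cases hal : a = l
        · subst hal
          simp only [if_true, if_neg hak]
          field_simp; simp
        · simp [hak, hal]
    have h4 := form_blowUp hB t x
    have h5 : p * N * δ ≤ x ⬝ᵥ blowUp B t *ᵥ x := by
      rw [h4, hbs]
      calc p * N * δ ≤ p * N * ∑ a, (B a k - B a l) ^ 2 := by
            gcongr; exact hδ k l hkl
        _ ≤ _ := by
            rw [Finset.mul_sum]
            refine Finset.sum_le_sum fun a _ => ?_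
            simp only [Matrix.mulVec_sub, Matrix.mulVec_single_one, Pi.sub_apply, Matrix.col_apply]
            exact mul_le_mul_of_nonneg_right (hn a) (sq_nonneg _)
    have h6 := form_sub_le_sum_castLE hU hM hdN hF0 hbot x
    rw [← norm_sq_sum_smul_embedding hsvd.nonneg hdN x, ← h1] at h6
    have h7 := (abs_le.1 (hform x)).1
    have h8 := mul_le_mul_of_nonneg_left hx hF0
    have h9 : N * (p * δ - 8 * ε / p) = p * N * δ - 2 * (F * (2 / (p * N))) := by
      rw [hFdef]; field_simp; ring
    linarith
  have hp1 : p ≤ 1 ∨ ∀ k l : Fin K, k = l := by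
    by_cases h : Nonempty (Fin K)
    · left
      obtain ⟨k⟩ := h
      have h1 : (blockSize t k : ℝ) ≤ N := by
        have : blockSize t k ≤ N := (Finset.card_le_univ _).trans (by simp)
        exact_mod_cast this
      have := (hn k).trans h1
      exact le_of_mul_le_mul_right (by linarith) hNpos
    · exact Or.inr fun k => (h ⟨k⟩).elim
  obtain ⟨c, hc⟩ := hτ
  have hkm : ∀ (c₂ : Fin K → Fin d → ℝ) (τ₂ : Fin N → Fin K),
      kmeansCost (Matrix.of fun u j => U u (Fin.castLE hdN j) *
        Real.sqrt (σ (Fin.castLE hdN j))) c₂ τ₂ = ∑ u, ‖s u - WithLp.toLp 2 (c₂ (τ₂ u))‖ ^ 2 :=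
    fun c₂ τ₂ => by
      refine Finset.sum_congr rfl fun u _ => ?_
      rw [EuclideanSpace.real_norm_sq_eq]
      rfl
  obtain ⟨ρ, hρ⟩ := exists_perm_of_kmeans_optimal s t τ' (fun k => WithLp.toLp 2 (c k)) m
    (η := η) (r := r) (Real.sqrt_nonneg _) hnear
    (fun c₂ τ₂ => by
      have := hc (fun k => (c₂ k).ofLp) τ₂
      rw [hkm, hkm] at this
      exact this)
    (fun k => by exact_mod_cast hblock k)
    (fun k => by
      rw [hη2, hr2]
      calc N * (10 * C * ε ^ 2 * N / p ^ 2) = 10 * C * ε ^ 2 * N / p ^ 3 * (p * N) := by field_simp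
        _ ≤ _ := by gcongr; exact hn k)
    -- Since `p ≤ 1`, `η ≤ r` and a gap of `6r` is enough; squaring it gives the `360 = 36 · 10` in
    -- `hε3`.
    (fun k l hkl => by
      have hp1 : p ≤ 1 := hp1.resolve_right fun h => hkl (h k l)
      have h1 : η ≤ r := by
        refine Real.sqrt_le_sqrt ?_
        exact div_le_div_of_nonneg_left (by positivity) (by positivity)
          (pow_le_pow_of_le_one hp.le hp1 (by norm_num))
      have h2 : 6 * r < ‖m k - m l‖ := by
        refine lt_of_pow_lt_pow_left₀ 2 (norm_nonneg _) (lt_of_lt_of_le ?_ (hsep k l hkl))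
        rw [mul_pow, hr2]
        calc 6 ^ 2 * (10 * C * ε ^ 2 * N / p ^ 3) = N * (360 * C * ε ^ 2 / p ^ 3) := by ring
          _ < _ := by
            refine mul_lt_mul_of_pos_left ?_ hNpos
            linarith
      linarith)
  exact misclustered_eq_zero ρ hρ

end Recovery

/-! ### Independence of groups and Hoeffding's inequality -/

section Concentration

variable {Ω : Type*} [MeasurableSpace Ω] {μ : Measure Ω}

/-- Groups of variables of an independent family are independent. -/
lemma iIndepFun_curry {ι : Type*} {κ : ι → Type*} {X : (i : ι) → κ i → Ω → ℝ}
    (mX : ∀ i j, Measurable (X i j))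
    (h : iIndepFun (fun (p : (i : ι) × κ i) ω => X p.1 p.2 ω) μ) :
    iIndepFun (fun i ω j => X i j ω) μ := by
  have := h.isProbabilityMeasure
  have : ∀ i j, IsProbabilityMeasure (μ.map (X i j)) :=
    fun i j => Measure.isProbabilityMeasure_map (mX i j).aemeasurable
  have hrow : ∀ i, iIndepFun (X i) μ := fun i =>
    h.precomp (g := fun j => (⟨i, j⟩ : (i : ι) × κ i)) fun j j' hj => by simpa using hj
  -- In terms of laws: currying a product measure gives a product of product measures.
  rw [iIndepFun_iff_map_fun_eq_infinitePi_map (by fun_prop)]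
  have hc : (MeasurableEquiv.piCurry (fun i (_ : κ i) => ℝ)) ∘ (fun ω p => X p.1 p.2 ω)
      = fun ω i j => X i j ω := by
    ext; simp [Sigma.curry]
  have hmap : μ.map (fun ω (p : (i : ι) × κ i) => X p.1 p.2 ω)
      = Measure.infinitePi fun p : (i : ι) × κ i => μ.map (X p.1 p.2) :=
    h.map_fun_eq_infinitePi_map fun p => mX p.1 p.2
  rw [← hc, ← Measure.map_map (by fun_prop) (by fun_prop), hmap,
    Measure.infinitePi_map_piCurry (fun i j => μ.map (X i j))]
  congr 1
  ext1 i
  exact ((hrow i).map_fun_eq_infinitePi_map (mX i)).symm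

/-- Two-sided Hoeffding inequality for independent variables with values in `[0, 1]`. -/
lemma measure_abs_sum_sub_ge_le [IsProbabilityMeasure μ] {V : Type*} [Fintype V] {X : V → Ω → ℝ}
    (mX : ∀ v, Measurable (X v)) (hX : ∀ v ω, X v ω ∈ Set.Icc (0 : ℝ) 1) (h : iIndepFun X μ)
    {a : ℝ} (ha : 0 ≤ a) :
    μ.real {ω | a ≤ |∑ v, X v ω - ∑ v, ∫ ω, X v ω ∂μ|}
      ≤ 2 * Real.exp (-(2 * a ^ 2 / Fintype.card V)) := by
  have hsub : ∀ v, HasSubgaussianMGF (fun ω => X v ω - ∫ ω, X v ω ∂μ) (1 / 4) μ := fun v => by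
    have := hasSubgaussianMGF_of_mem_Icc (mX v).aemeasurable (Filter.Eventually.of_forall (hX v))
      (μ := μ)
    convert this using 1
    ext; norm_num
  have hind : iIndepFun (fun v ω => X v ω - ∫ ω, X v ω ∂μ) μ :=
    h.comp (fun v x => x - ∫ ω, X v ω ∂μ) fun v => by fun_prop
  have hneg : iIndepFun (fun v ω => -(X v ω - ∫ ω, X v ω ∂μ)) μ :=
    h.comp (fun v x => -(x - ∫ ω, X v ω ∂μ)) fun v => by fun_prop
  have hexp : -a ^ 2 / (2 * ((∑ _v : V, (1 / 4 : NNReal) : NNReal) : ℝ))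
      = -(2 * a ^ 2 / Fintype.card V) := by
    rcases eq_or_ne (Fintype.card V : ℝ) 0 with h0 | h0
    · simp [h0]
    · simp; field_simp; norm_num
  have h1 := HasSubgaussianMGF.measure_sum_ge_le_of_iIndepFun hind (s := Finset.univ)
    (fun v _ => hsub v) ha
  have h2 := HasSubgaussianMGF.measure_sum_ge_le_of_iIndepFun hneg (s := Finset.univ)
    (fun v _ => (hsub v).neg) ha
  push_cast at hexp h1 h2
  rw [hexp] at h1 h2
  rw [two_mul]
  refine le_trans ?_ (add_le_add h1 h2)
  refine le_trans (measureReal_mono fun ω hω => ?_) (measureReal_union_le _ _)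
  rcases le_abs.1 (show a ≤ _ from hω) with h | h
  · left; simpa [Finset.sum_sub_distrib] using h
  · right
    simpa [Finset.sum_sub_distrib] using h

end Concentration

/-! ### Common neighbours in the block model -/

section Model

variable {K N : ℕ} {Ω : Type*} [MeasurableSpace Ω] {B : Matrix (Fin K) (Fin K) ℝ}
  {P : Measure Ω} {τ : Ω → Fin N → Fin K} {A : Ω → Matrix (Fin N) (Fin N) ℝ}

lemma doubledBlockMatrix_apply (B : Matrix (Fin K) (Fin K) ℝ) (t : Fin N → Fin K) (k l : Fin K) :
    doubledBlockMatrix B t k l = ∑ v, B k (t v) * B (t v) l := by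
  rw [sum_comp_eq_sum_blockSize t (fun m => B k m * B m l), doubledBlockMatrix, Matrix.mul_apply]
  exact Finset.sum_congr rfl fun m _ => by rw [Matrix.mul_diagonal]; ring

/-- The edge between two distinct nodes. -/
def edge (a b : Fin N) (h : a ≠ b) : {e : Fin N × Fin N // e.1 < e.2} :=
  ⟨(min a b, max a b), min_lt_max.2 h⟩

lemma IsUndirectedSBM.apply_edge (hA : IsUndirectedSBM B P τ A) {a b : Fin N} (h : a ≠ b) (ω : Ω) :
    A ω (edge a b h).1.1 (edge a b h).1.2 = A ω a b := by
  rcases lt_or_gt_of_ne h with h | h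
  · simp [edge, min_eq_left h.le, max_eq_right h.le]
  · simp only [edge, min_eq_right h.le, max_eq_left h.le]
    exact (hA.symm ω).apply a b

lemma IsUndirectedSBM.integral_entry (hA : IsUndirectedSBM B P τ A) (hB : B.IsSymm)
    {t : Fin N → Fin K} (ht : P (τ ⁻¹' {t}) ≠ 0) {a b : Fin N} (h : a ≠ b) :
    ∫ ω, A ω a b ∂(cond P (τ ⁻¹' {t})) = B (t a) (t b) := by
  have hind : (fun ω => A ω a b) = Set.indicator {ω | A ω a b = 1} 1 := by
    ext ω
    rcases hA.zero_or_one ω a b with h | h <;> simp [Set.indicator, h]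
  rw [hind, integral_indicator_one (measurableSet_eq_fun (hA.measurable_entry a b) measurable_const)]
  rcases lt_or_gt_of_ne h with h | h
  · exact hA.bernoulli t ht a b h
  · rw [← hB.apply (t a) (t b), ← hA.bernoulli t ht b a h]
    congr 1
    ext ω
    simp only [Set.mem_ofPred_eq]
    rw [(hA.symm ω).apply]

/-- Concentration of the number of common neighbours of two nodes. -/
lemma IsUndirectedSBM.cond_entry_le [IsFiniteMeasure P] (hA : IsUndirectedSBM B P τ A)
    (hB : B.IsSymm)
    (hB01 : ∀ k l, 0 ≤ B k l ∧ B k l ≤ 1) {t : Fin N → Fin K} (ht : P (τ ⁻¹' {t}) ≠ 0)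
    {u w : Fin N} (huw : u ≠ w) (hN : 3 ≤ N) {a : ℝ} (ha : 0 ≤ a) :
    (cond P (τ ⁻¹' {t})).real
        {ω | a + 2 ≤ |(A ω * A ω) u w - doubledBlockMatrix B t (t u) (t w)|}
      ≤ 2 * Real.exp (-(2 * a ^ 2 / N)) := by
  set μ := cond P (τ ⁻¹' {t}) with hμ
  have : IsProbabilityMeasure μ := cond_isProbabilityMeasure ht
  -- For `v` outside `{u, w}` the edges `uv` and `vw` are pairwise distinct, so the products over
  -- `v` are independent.
  let V := {v : Fin N // v ≠ u ∧ v ≠ w}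
  let e : (v : V) × Bool → {e : Fin N × Fin N // e.1 < e.2} := fun p =>
    if p.2 then edge u p.1.1 p.1.2.1.symm else edge p.1.1 w p.1.2.2
  have he : Function.Injective e := by
    rintro ⟨⟨v, hv⟩, c⟩ ⟨⟨v', hv'⟩, c'⟩ h
    have h1 := congrArg (fun x => x.1.1) h
    have h2 := congrArg (fun x => x.1.2) h
    cases c <;> cases c' <;> simp [e, edge] at h1 h2 <;> grind
  let Y : V → Bool → Ω → ℝ := fun v c ω => if c then A ω u v.1 else A ω v.1 w
  have hYm : ∀ v c, Measurable (Y v c) := fun v c => by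
    cases c
    · exact hA.measurable_entry _ _
    · exact hA.measurable_entry _ _
  have hYind : iIndepFun (fun (p : (v : V) × Bool) ω => Y p.1 p.2 ω) μ := by
    have := (hA.indep t ht).precomp he
    convert this using 2 with p
    ext ω
    obtain ⟨v, c⟩ := p
    cases c
    · exact (hA.apply_edge v.2.2 ω).symm
    · exact (hA.apply_edge v.2.1.symm ω).symm
  let X : V → Ω → ℝ := fun v ω => A ω u v.1 * A ω v.1 w
  have hXind : iIndepFun X μ :=
    (iIndepFun_curry hYm hYind).comp (fun _ y => y true * y false) fun _ => by fun_prop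
  have hXm : ∀ v, Measurable (X v) := fun v =>
    (hA.measurable_entry _ _).mul (hA.measurable_entry _ _)
  have hX01 : ∀ v ω, X v ω ∈ Set.Icc (0 : ℝ) 1 := fun v ω => by
    rcases hA.zero_or_one ω u v.1 with h1 | h1 <;> rcases hA.zero_or_one ω v.1 w with h2 | h2 <;>
      simp [X, h1, h2]
  have hXE : ∀ v : V, ∫ ω, X v ω ∂μ = B (t u) (t v.1) * B (t v.1) (t w) := fun v => by
    have hi : IndepFun (Y v true) (Y v false) μ :=
      hYind.indepFun (i := ⟨v, true⟩) (j := ⟨v, false⟩) (by simp)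
    have := hi.integral_fun_mul_eq_mul_integral (hYm v true).aestronglyMeasurable
      (hYm v false).aestronglyMeasurable
    rw [← hA.integral_entry hB ht v.2.1.symm, ← hA.integral_entry hB ht v.2.2]
    exact this
  have hsplit : ∀ f : Fin N → ℝ, ∑ v, f v = ∑ v : V, f v.1 + (f u + f w) := fun f => by
    rw [← Finset.sum_filter_add_sum_filter_not Finset.univ (fun v => v ≠ u ∧ v ≠ w)]
    congr 1
    · exact Finset.sum_subtype _ (by simp) f
    · rw [← Finset.sum_pair huw]
      congr 1
      ext v; simp; tauto
  -- The terms `v = u` and `v = w` vanish in `A²` for lack of loops, but each adds up to 1 to `B̃`: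
  -- hence the `2`.
  have hsub : {ω | a + 2 ≤ |(A ω * A ω) u w - doubledBlockMatrix B t (t u) (t w)|}
      ⊆ {ω | a ≤ |∑ v, X v ω - ∑ v, ∫ ω, X v ω ∂μ|} := fun ω hω => by
    simp only [Set.mem_ofPred_eq] at hω ⊢
    rw [Matrix.mul_apply, doubledBlockMatrix_apply, hsplit, hsplit, hA.no_loop, hA.no_loop] at hω
    simp only [hXE]
    have h1 : ∀ k l m, 0 ≤ B k l * B l m ∧ B k l * B l m ≤ 1 := fun k l m =>
      ⟨mul_nonneg (hB01 k l).1 (hB01 l m).1,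
        mul_le_one₀ (hB01 k l).2 (hB01 l m).1 (hB01 l m).2⟩
    have h2 := h1 (t u) (t u) (t w)
    have h3 := h1 (t u) (t w) (t w)
    set Z := ∑ v : V, B (t u) (t v.1) * B (t v.1) (t w)
    change a + 2 ≤ |∑ v, X v ω + _ - _| at hω
    set W := ∑ v : V, X v ω
    have h4 := abs_sub_abs_le_abs_sub
      (W + (0 * A ω u w + A ω u w * 0) -
        (Z + (B (t u) (t u) * B (t u) (t w) + B (t u) (t w) * B (t w) (t w)))) (W - Z)
    have h5 : |(W + (0 * A ω u w + A ω u w * 0) -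
        (Z + (B (t u) (t u) * B (t u) (t w) + B (t u) (t w) * B (t w) (t w)))) - (W - Z)| ≤ 2 := by
      rw [abs_le]; constructor <;> linarith
    linarith
  refine (measureReal_mono hsub).trans
    ((measure_abs_sum_sub_ge_le hXm hX01 hXind ha).trans ?_)
  have hVN : Fintype.card V ≤ N := (Fintype.card_subtype_le _).trans (by simp)
  -- Replacing `card V` by `N` in the denominator needs it positive, since division by zero gives
  -- zero; hence `3 ≤ N`.
  have hV0 : 0 < Fintype.card V := by
    obtain ⟨v, -, hv⟩ := Finset.exists_mem_notMem_of_card_lt_card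
      (s := {u, w}) (t := (Finset.univ : Finset (Fin N)))
      (lt_of_le_of_lt Finset.card_le_two (by rw [Finset.card_univ, Fintype.card_fin]; omega))
    exact Fintype.card_pos_iff.2 ⟨⟨v, by simpa using hv⟩⟩
  gcongr

/-- The diagonal of `A²` is within `N` of that of the blown-up matrix. -/
lemma IsUndirectedSBM.abs_diag_le (hA : IsUndirectedSBM B P τ A)
    (hB01 : ∀ k l, 0 ≤ B k l ∧ B k l ≤ 1) (t : Fin N → Fin K) (ω : Ω) (u : Fin N) :
    |(A ω * A ω) u u - doubledBlockMatrix B t (t u) (t u)| ≤ N := by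
  rw [Matrix.mul_apply, doubledBlockMatrix_apply, ← Finset.sum_sub_distrib]
  calc |∑ v, (A ω u v * A ω v u - B (t u) (t v) * B (t v) (t u))|
      ≤ ∑ v, |A ω u v * A ω v u - B (t u) (t v) * B (t v) (t u)| := Finset.abs_sum_le_sum_abs _ _
    _ ≤ ∑ _v : Fin N, (1 : ℝ) := Finset.sum_le_sum fun v _ => by
        have h1 := mul_nonneg (hB01 (t u) (t v)).1 (hB01 (t v) (t u)).1
        have h2 := mul_le_one₀ (hB01 (t u) (t v)).2 (hB01 (t v) (t u)).1 (hB01 (t v) (t u)).2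
        rw [(hA.symm ω).apply u v, abs_le]
        rcases hA.zero_or_one ω u v with h | h <;> rw [h] <;> constructor <;> linarith
    _ = N := by simp

/-- With high probability all off-diagonal entries of `A²` concentrate. -/
lemma IsUndirectedSBM.prob_deviation_le [IsProbabilityMeasure P] (hA : IsUndirectedSBM B P τ A)
    (hB : B.IsSymm) (hB01 : ∀ k l, 0 ≤ B k l ∧ B k l ≤ 1) (hN : 3 ≤ N) {a : ℝ} (ha : 0 ≤ a) :
    P.real {ω | ∃ u w, u ≠ w ∧
        a + 2 ≤ |(A ω * A ω) u w - doubledBlockMatrix B (τ ω) (τ ω u) (τ ω w)|}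
      ≤ N ^ 2 * (2 * Real.exp (-(2 * a ^ 2 / N))) := by
  set bad := {ω | ∃ u w, u ≠ w ∧
        a + 2 ≤ |(A ω * A ω) u w - doubledBlockMatrix B (τ ω) (τ ω u) (τ ω w)|} with hbad
  set q := 2 * Real.exp (-(2 * a ^ 2 / (N : ℝ))) with hq
  have hq0 : 0 ≤ q := by positivity
  have hcond : ∀ t, P (τ ⁻¹' {t}) ≠ 0 → (cond P (τ ⁻¹' {t})).real bad ≤ N ^ 2 * q := fun t ht => by
    have : IsProbabilityMeasure (cond P (τ ⁻¹' {t})) := cond_isProbabilityMeasure ht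
    have hmeas : MeasurableSet (τ ⁻¹' {t}) := hA.measurable_membership (measurableSet_singleton t)
    let D : Fin N × Fin N → Set Ω := fun p => if p.1 = p.2 then ∅ else
      {ω | a + 2 ≤ |(A ω * A ω) p.1 p.2 - doubledBlockMatrix B t (t p.1) (t p.2)|}
    -- Under the conditional measure `τ = t` almost surely, which makes the centering deterministic.
    have h1 : (cond P (τ ⁻¹' {t})).real bad ≤ (cond P (τ ⁻¹' {t})).real (⋃ p, D p) := by
      refine ENNReal.toReal_mono (measure_ne_top _ _) (measure_mono_ae ?_)
      filter_upwards [ae_cond_mem hmeas] with ω hω hωb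
      obtain ⟨u, w, huw, h⟩ := hωb
      rw [show τ ω = t from hω] at h
      exact Set.mem_iUnion.2 ⟨(u, w), by simpa [D, huw] using h⟩
    refine h1.trans ((measureReal_iUnion_fintype_le _).trans ?_)
    calc ∑ p, (cond P (τ ⁻¹' {t})).real (D p) ≤ ∑ _p : Fin N × Fin N, q := by
          refine Finset.sum_le_sum fun p _ => ?_
          by_cases hp : p.1 = p.2
          · simp [D, hp, hq0]
          · simp only [D, hp, if_false]
            exact hA.cond_entry_le hB hB01 ht hp hN ha
      _ = N ^ 2 * q := by rw [Finset.sum_const, nsmul_eq_mul]; simp [sq]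
  have htot : ∀ s : Set Ω, P.real s
      = ∑ t, P.real (τ ⁻¹' {t}) * (cond P (τ ⁻¹' {t})).real s := fun s => by
    have h := congrArg (fun m => m s) (sum_meas_smul_cond_fiber hA.measurable_membership P)
    simp only [Measure.coe_finsetSum, Finset.sum_apply, Measure.smul_apply, smul_eq_mul] at h
    rw [Measure.real, ← h, ENNReal.toReal_sum fun t _ =>
      ENNReal.mul_ne_top (measure_ne_top _ _) (measure_ne_top _ _)]
    simp [Measure.real]
  have hone : ∑ t, P.real (τ ⁻¹' {t}) = 1 := by
    rw [← probReal_univ (μ := P), htot Set.univ]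
    refine Finset.sum_congr rfl fun t _ => ?_
    by_cases ht : P (τ ⁻¹' {t}) = 0
    · simp [Measure.real, ht]
    · have : IsProbabilityMeasure (cond P (τ ⁻¹' {t})) := cond_isProbabilityMeasure ht
      simp
  rw [htot]
  calc ∑ t, P.real (τ ⁻¹' {t}) * (cond P (τ ⁻¹' {t})).real bad
      ≤ ∑ t, P.real (τ ⁻¹' {t}) * (N ^ 2 * q) := by
        refine Finset.sum_le_sum fun t _ => ?_
        by_cases ht : P (τ ⁻¹' {t}) = 0
        · simp [Measure.real, ht]
        · exact mul_le_mul_of_nonneg_left (hcond t ht) measureReal_nonneg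
    _ = N ^ 2 * q := by rw [← Finset.sum_mul, hone, one_mul]

end Model

/-! ### Separated factors force distinct columns -/

section Separation

open Matrix

variable {K N d : ℕ}

lemma mulVec_injective_of_rank_eq {ν : Matrix (Fin K) (Fin d) ℝ} (h : ν.rank = d) {x : Fin d → ℝ}
    (hx : ν *ᵥ x = 0) : x = 0 := by
  have h1 := ν.mulVecLin.finrank_range_add_finrank_ker
  have h2 : Module.finrank ℝ (LinearMap.range ν.mulVecLin) = d := h
  rw [h2, Module.finrank_fin_fun] at h1
  have h3 : LinearMap.ker ν.mulVecLin = ⊥ := Submodule.finrank_eq_zero.1 (by omega)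
  have : x ∈ LinearMap.ker ν.mulVecLin := hx
  rwa [h3, Submodule.mem_bot] at this

/-- The form of `B̃` at `y` is a sum of squares of `B y` with positive weights, so both matrices
have the same kernel. -/
lemma rank_doubledBlockMatrix {B : Matrix (Fin K) (Fin K) ℝ} (hB : B.IsSymm) {t : Fin N → Fin K}
    (ht : ∀ k, 0 < blockSize t k) : (doubledBlockMatrix B t).rank = B.rank := by
  have hker : LinearMap.ker (doubledBlockMatrix B t).mulVecLin = LinearMap.ker B.mulVecLin := by
    ext y
    simp only [LinearMap.mem_ker, Matrix.mulVecLin_apply, doubledBlockMatrix]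
    constructor
    · intro h
      have h1 : ∑ m, (blockSize t m : ℝ) * (B *ᵥ y) m ^ 2 = 0 := by
        have h2 : y ⬝ᵥ (B * Matrix.diagonal (fun k => (blockSize t k : ℝ)) * B) *ᵥ y = 0 := by
          rw [h, dotProduct_zero]
        rw [← Matrix.mulVec_mulVec, ← Matrix.mulVec_mulVec, Matrix.dotProduct_mulVec,
          ← Matrix.mulVec_transpose, hB.eq] at h2
        rw [← h2]
        simp only [dotProduct, Matrix.mulVec_diagonal]
        exact Finset.sum_congr rfl fun j _ => by ring
      ext m
      have h3 := (Finset.sum_eq_zero_iff_of_nonneg fun m _ => by positivity).1 h1 m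
        (Finset.mem_univ m)
      have h4 : (blockSize t m : ℝ) ≠ 0 := by exact_mod_cast (ht m).ne'
      simpa [h4] using h3
    · intro h
      rw [← Matrix.mulVec_mulVec, h, Matrix.mulVec_zero]
  have h1 := (doubledBlockMatrix B t).mulVecLin.finrank_range_add_finrank_ker
  have h2 := B.mulVecLin.finrank_range_add_finrank_ker
  rw [hker] at h1
  unfold Matrix.rank
  omega

/-- Separation of the factors of `B̃` forces distinct columns of `B`. -/
lemma IsSeparated.col_ne {B : Matrix (Fin K) (Fin K) ℝ} (hB : B.IsSymm) (hrank : B.rank = d)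
    {t : Fin N → Fin K} (ht : ∀ k, 0 < blockSize t k) {β : ℝ} (hβ : 0 ≤ β)
    (h : IsSeparated (doubledBlockMatrix B t) d β) {k l : Fin K} (hkl : k ≠ l) :
    ∃ m, B m k ≠ B m l := by
  by_contra! hcol
  obtain ⟨ν, μ, hνμ, hsep⟩ := h
  have hr := rank_doubledBlockMatrix hB ht
  rw [hrank, hνμ] at hr
  -- Both factors have full column rank and can be cancelled: equal rows of `B̃` give equal rows of
  -- `ν`, equal columns give equal rows of `μ`.
  have hνr : ν.rank = d := le_antisymm (by simpa using ν.rank_le_width)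
    (hr.ge.trans (Matrix.rank_mul_le_left ν μ.transpose))
  have hμr : μ.rank = d := le_antisymm (by simpa using μ.rank_le_width)
    (by rw [← Matrix.rank_transpose μ]; exact hr.ge.trans (Matrix.rank_mul_le_right ν μ.transpose))
  have hrow : ∀ m, doubledBlockMatrix B t k m = doubledBlockMatrix B t l m := fun m => by
    rw [doubledBlockMatrix_apply, doubledBlockMatrix_apply]
    refine Finset.sum_congr rfl fun v _ => ?_
    rw [← hB.apply k, ← hB.apply l, hcol]
  have hcol' : ∀ m, doubledBlockMatrix B t m k = doubledBlockMatrix B t m l := fun m => by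
    rw [doubledBlockMatrix_apply, doubledBlockMatrix_apply]
    exact Finset.sum_congr rfl fun v _ => by rw [hcol]
  have h1 : ν k - ν l = 0 := mulVec_injective_of_rank_eq hμr (by
    ext m
    have := hrow m
    simp only [hνμ, Matrix.mul_apply, Matrix.transpose_apply] at this
    simp only [Matrix.mulVec, dotProduct, Pi.sub_apply, mul_sub, Finset.sum_sub_distrib,
      Pi.zero_apply, sub_eq_zero]
    simpa only [mul_comm] using this)
  have h2 : μ k - μ l = 0 := mulVec_injective_of_rank_eq hνr (by
    ext m
    have := hcol' m
    simp only [hνμ, Matrix.mul_apply, Matrix.transpose_apply] at this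
    simp only [Matrix.mulVec, dotProduct, Pi.sub_apply, mul_sub, Finset.sum_sub_distrib,
      Pi.zero_apply, sub_eq_zero]
    exact this)
  rcases hsep k l hkl with h | h
  · rw [rowDist, h1] at h; simp at h; linarith
  · rw [rowDist, h2] at h; simp at h; linarith

end Separation

/-! ### Choice of constants and the main theorem -/

lemma exists_pos_le_of_finite {ι : Type*} [Finite ι] {f : ι → ℝ} (hf : ∀ i, 0 < f i) :
    ∃ δ, 0 < δ ∧ ∀ i, δ ≤ f i := by
  have h : ∀ᶠ δ in nhdsWithin (0 : ℝ) (Set.Ioi 0), ∀ i, δ ≤ f i :=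
    Filter.eventually_all.2 fun i =>
      (Filter.Eventually.filter_mono nhdsWithin_le_nhds (Iic_mem_nhds (hf i)))
  obtain ⟨δ, h1, h2⟩ := (h.and self_mem_nhdsWithin).exists
  exact ⟨δ, h2, h1⟩

/-- The upper constraints hold strictly at `ε = 0`, hence nearby by continuity. -/
lemma exists_small_parameter {C δ p : ℝ} (hC : 0 < C) (hδ : 0 < δ) (hp : 0 < p) :
    ∃ ε : ℝ, 0 < ε ∧ ε ≤ 1 ∧ 4 * ε ≤ p ^ 2 / C ∧
      360 * C * ε ^ 2 / p ^ 3 + 8 * ε / p < p * δ := by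
  have h1 : ∀ᶠ ε in nhds (0 : ℝ), ε < 1 := gt_mem_nhds one_pos
  have h2 : ∀ᶠ ε in nhds (0 : ℝ), 4 * ε < p ^ 2 / C :=
    (by fun_prop : Continuous fun ε : ℝ => 4 * ε).tendsto 0 |>.eventually_lt_const
      (by simp; positivity)
  have h3 : ∀ᶠ ε in nhds (0 : ℝ), 360 * C * ε ^ 2 / p ^ 3 + 8 * ε / p < p * δ :=
    (by fun_prop : Continuous fun ε : ℝ => 360 * C * ε ^ 2 / p ^ 3 + 8 * ε / p).tendsto 0
      |>.eventually_lt_const (by simp; positivity)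
  obtain ⟨ε, ⟨h1, h2, h3⟩, h4⟩ :=
    (((h1.and (h2.and h3)).filter_mono nhdsWithin_le_nhds).and
      (self_mem_nhdsWithin (s := Set.Ioi (0 : ℝ)))).exists
  exact ⟨ε, h4, h1.le, h2.le, h3⟩

/-- Deviation `εN/2` makes the exponent `-ε²N/2`, which beats `N⁴`; `4 ≤ εN` lets the additive `2`
fit into the other half of `εN`. -/
lemma eventually_union_bound_le {ε : ℝ} (hε : 0 < ε) :
    ∀ᶠ N : ℕ in Filter.atTop, 3 ≤ N ∧ 8 ≤ N * ε ^ 2 ∧ 4 ≤ ε * N ∧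
      (N : ℝ) ^ 2 * (2 * Real.exp (-(2 * (ε * N / 2) ^ 2 / N))) ≤ 2 / (N : ℝ) ^ 2 := by
  have hcast := tendsto_natCast_atTop_atTop (R := ℝ)
  have h1 : ∀ᶠ N : ℕ in Filter.atTop, (8 : ℝ) ≤ N * ε ^ 2 :=
    (hcast.atTop_mul_const (by positivity)).eventually_ge_atTop 8
  have h2 : ∀ᶠ N : ℕ in Filter.atTop, (4 : ℝ) ≤ ε * N :=
    (hcast.const_mul_atTop hε).eventually_ge_atTop 4
  have h3 : ∀ᶠ x : ℝ in Filter.atTop, x ^ 4 * Real.exp (-(ε ^ 2 / 2) * x) < 1 := by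
    have h := tendsto_rpow_mul_exp_neg_mul_atTop_nhds_zero 4 (ε ^ 2 / 2) (by positivity)
    filter_upwards [h.eventually_lt_const one_pos] with x hx
    have h4 : x ^ (4 : ℝ) = x ^ 4 := by exact_mod_cast Real.rpow_natCast x 4
    rwa [h4] at hx
  filter_upwards [Filter.eventually_ge_atTop 3, h1, h2, hcast.eventually h3] with N hN a1 a2 a3
  refine ⟨hN, a1, a2, ?_⟩
  have hN0 : (0 : ℝ) < N := by exact_mod_cast (by omega : 0 < N)
  rw [le_div_iff₀ (by positivity)]
  have : -(2 * (ε * N / 2) ^ 2 / N) = -(ε ^ 2 / 2) * (N : ℝ) := by field_simp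
  rw [this]
  nlinarith

end DASE

end

open DASE in
theorem mainTheorem5 (K d : ℕ) (B : Matrix (Fin K) (Fin K) ℝ)
    (hB01 : ∀ k l, 0 ≤ B k l ∧ B k l ≤ 1) (hBsymm : B.IsSymm) (hBrank : B.rank = d)
    (piMin : ℝ) (hpi : 0 < piMin) :
    ∃ N₀ : ℕ, ∀ N : ℕ, N₀ ≤ N → ∀ (b β : ℝ), 0 < b → 0 < β →
      ∀ (Ω : Type*) [MeasurableSpace Ω] (P : Measure Ω) [IsProbabilityMeasure P]
        (τ : Ω → Fin N → Fin K) (A : Ω → Matrix (Fin N) (Fin N) ℝ),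
        DASE.IsUndirectedSBM B P τ A →
        (∀ᵐ ω ∂P, ∀ k, piMin ≤ (DASE.blockSize (τ ω) k : ℝ) / N) →
        (∀ᵐ ω ∂P, b * N ≤ DASE.singularValue (DASE.doubledBlockMatrix B (τ ω)) d) →
        (∀ᵐ ω ∂P, DASE.IsSeparated (DASE.doubledBlockMatrix B (τ ω)) d (β * N)) →
        1 - 2 / (N : ℝ) ^ 2 ≤
          P.real {ω | ∀ (S : Matrix (Fin N) (Fin d) ℝ) (τ' : Fin N → Fin K),
            DASE.IsSpectralEmbedding (A ω * A ω) S → DASE.IsKMeansAssignment S τ' →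
            (DASE.misclustered (τ ω) τ' : ℝ) ≤
              2 ^ 4 * 3 ^ 2 / (β ^ 2 * (b * piMin) ^ 5) * (Real.log N / N)} := by
  -- If two columns of `B` coincide, the separation assumption fails for every `N ≥ 1` and the claim
  -- is vacuous.
  by_cases hcol : ∀ k l, k ≠ l → ∃ m, B m k ≠ B m l
  swap
  · refine ⟨1, fun N hN b β hb hβ Ω _ P _ τ A hA h1 _ h3 => absurd (fun k l hkl => ?_) hcol⟩
    have hN0 : (0 : ℝ) < N := by exact_mod_cast hN
    obtain ⟨ω, hω1, hω3⟩ := (h1.and h3).exists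
    refine hω3.col_ne hBsymm hBrank (fun k => ?_) (by positivity) hkl
    have : (0 : ℝ) < blockSize (τ ω) k := by
      have := (le_div_iff₀ hN0).1 (hω1 k)
      exact lt_of_lt_of_le (by positivity) this
    exact_mod_cast this
  obtain ⟨δ, hδ0, hδ⟩ := exists_pos_le_of_finite
    (f := fun e : {e : Fin K × Fin K // e.1 ≠ e.2} => ∑ m, (B m e.1.1 - B m e.1.2) ^ 2) (fun e => by
      obtain ⟨m, hm⟩ := hcol _ _ e.2
      have := sub_ne_zero.2 hm
      exact Finset.sum_pos' (fun _ _ => sq_nonneg _) ⟨m, Finset.mem_univ _, by positivity⟩)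
  obtain ⟨C, hC, hrange⟩ := exists_bounded_preimage B
  obtain ⟨ε, hε0, hε1, hε2, hε3⟩ := exists_small_parameter hC hδ0 hpi
  obtain ⟨N₀, hN₀⟩ := Filter.eventually_atTop.1 (eventually_union_bound_le hε0)
  refine ⟨N₀, fun N hN b β hb hβ Ω _ P _ τ A hA h1 _ _ => ?_⟩
  obtain ⟨hN3, hN8, hN4, hNexp⟩ := hN₀ N hN
  have hNpos : (0 : ℝ) < N := by exact_mod_cast (by omega : 0 < N)
  set bad := {ω | ∃ u w, u ≠ w ∧ ε * N / 2 + 2 ≤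
    |(A ω * A ω) u w - doubledBlockMatrix B (τ ω) (τ ω u) (τ ω w)|} with hbad
  have hprob : P.real bad ≤ 2 / (N : ℝ) ^ 2 :=
    (hA.prob_deviation_le hBsymm hB01 hN3 (by positivity)).trans hNexp
  set good := {ω | ∀ (S : Matrix (Fin N) (Fin d) ℝ) (τ' : Fin N → Fin K),
    IsSpectralEmbedding (A ω * A ω) S → IsKMeansAssignment S τ' →
    (misclustered (τ ω) τ' : ℝ) ≤
      2 ^ 4 * 3 ^ 2 / (β ^ 2 * (b * piMin) ^ 5) * (Real.log N / N)} with hgood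
  -- Covering almost everything and using subadditivity avoids any measurability of `good`.
  have hcover : P.real Set.univ ≤ P.real (good ∪ bad) := by
    refine ENNReal.toReal_mono (measure_ne_top _ _) (measure_mono_ae ?_)
    filter_upwards [h1] with ω hω _
    by_cases hωb : ω ∈ bad
    · exact Or.inr hωb
    · refine Or.inl fun S τ' hS hτ => ?_
      have hoff : ∀ u w, u ≠ w →
          |(A ω * A ω) u w - doubledBlockMatrix B (τ ω) (τ ω u) (τ ω w)| ≤ ε * N :=
        fun u w huw => by
          by_contra! hcon
          exact hωb ⟨u, w, huw, by linarith⟩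
      rw [misclustered_eq_zero_of_close hBsymm hBrank hC hrange
        (fun k l hkl => hδ ⟨(k, l), hkl⟩) hpi hε0 hε1 hε2 hε3 (hA.symm ω)
        (fun k => (le_div_iff₀ hNpos).1 (hω k)) hN8 hoff (hA.abs_diag_le hB01 (τ ω) ω) hS hτ]
      have : 0 ≤ Real.log N := Real.log_natCast_nonneg N
      simp only [Nat.cast_zero]
      positivity
  rw [probReal_univ] at hcover
  linarith [measureReal_union_le (μ := P) good bad]
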